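/- Let $M$ be a connected, paracompact, Hausdorff smooth ($C^\infty$) manifold without boundary of finite dimension $m$. For a smooth Koszul connection $\nabla$ on $TM$ put $$T^\nabla(X,Y)=\nabla_XY-\nabla_YX-[X,Y],\qquad R^\nabla(X,Y)Z=\nabla_X\nabla_YZ-\nabla_Y\nabla_XZ-\nabla_{[X,Y]}Z,$$ $$(\nabla^2X)(Y,Z)=\nabla_Y\nabla_ZX-\nabla_{\nabla_YZ}X.$$ For $x\in M$ let $\mathcal T_\nabla M(x)\subset T_xM$ be the linear span of the values $X(x)$ of all smooth vector fields $X$ that are defined on some open neighbourhood of $x$ and satisfy $\nabla^2X=0$ there. Define $$r^b(\nabla)=\min_{x\in M}\dim \mathcal T_\nabla M(x),\qquad r^b(M)=\min_{\nabla}\bigl(m-r^b(\nabla)\bigr),$$ where the last minimum runs over all smooth torsion-free connections ($T^\nabla=0$) on $TM$. A locally flat structure on $M$ is a smooth connection $\nabla$ on $TM$ with $T^\nabla=0$ and $R^\nabla=0$. Then the following are equivalent: 1. $r^b(M)=0$; 2. $M$ admits a locally flat structure. -/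

import Mathlib

open scoped Manifold ContDiff Topology

noncomputable section

namespace LocallyFlat

variable {m : ℕ} {M : Type*} [TopologicalSpace M] [ChartedSpace (EuclideanSpace ℝ (Fin m)) M]

/-- The model of an `m`-dimensional manifold without boundary. -/
abbrev model (m : ℕ) :
    ModelWithCorners ℝ (EuclideanSpace ℝ (Fin m)) (EuclideanSpace ℝ (Fin m)) :=
  𝓘(ℝ, EuclideanSpace ℝ (Fin m))

/-- (Not necessarily smooth) vector fields on `M`. -/
abbrev VField (m : ℕ) (M : Type*) [TopologicalSpace M]
    [ChartedSpace (EuclideanSpace ℝ (Fin m)) M] : Type _ :=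
  (x : M) → TangentSpace (model m) x

/-- Koszul connections on the tangent bundle of `M`; smoothness is asked for separately. -/
abbrev Connection (m : ℕ) (M : Type*) [TopologicalSpace M]
    [ChartedSpace (EuclideanSpace ℝ (Fin m)) M] [IsManifold (model m) ∞ M] : Type _ :=
  CovariantDerivative (model m) (EuclideanSpace ℝ (Fin m))
    (TangentSpace (model m) : M → Type _)

variable [IsManifold (model m) ∞ M]

/-- The vector field `X` is smooth on the set `U`. -/
def SmoothOn (X : VField m M) (U : Set M) : Prop :=
  ContMDiffOn (model m) (model m).tangent ∞
    (fun x ↦ (⟨x, X x⟩ : TangentBundle (model m) M)) U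

/-- The covariant derivative `∇_X Y`. -/
def Connection.nabla (D : Connection m M) (X Y : VField m M) : VField m M :=
  fun x ↦ D Y x (X x)

/-- `(∇²X)(Y, Z) = ∇_Y ∇_Z X - ∇_{∇_Y Z} X`. -/
def Connection.hess (D : Connection m M) (X Y Z : VField m M) : VField m M :=
  D.nabla Y (D.nabla Z X) - D.nabla (D.nabla Y Z) X

/-- `R(X, Y)Z = ∇_X ∇_Y Z - ∇_Y ∇_X Z - ∇_{[X, Y]} Z`. -/
def Connection.curv (D : Connection m M) (X Y Z : VField m M) : VField m M :=
  D.nabla X (D.nabla Y Z) - D.nabla Y (D.nabla X Z)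
    - D.nabla (VectorField.mlieBracket (model m) X Y) Z

/-- Smooth torsion-free connections. -/
structure Connection.IsSymmetric (D : Connection m M) : Prop where
  smooth : CovariantDerivative.ContMDiffCovariantDerivative D ∞
  torsion_eq_zero : D.torsion = 0

/-- Locally flat structures: smooth torsion-free connections with zero curvature. -/
structure Connection.IsLocallyFlat (D : Connection m M) : Prop extends D.IsSymmetric where
  curv_eq_zero : ∀ X Y Z : VField m M,
    SmoothOn X Set.univ → SmoothOn Y Set.univ → SmoothOn Z Set.univ → D.curv X Y Z = 0

/-- `X` is a smooth solution of `∇²X = 0` on the set `U` (used for open `U`); the values of `X`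
outside `U` are irrelevant. -/
structure Connection.IsSolutionOn (D : Connection m M) (X : VField m M) (U : Set M) : Prop where
  smooth : SmoothOn X U
  hess_eq_zero : ∀ Y Z : VField m M, SmoothOn Y Set.univ → SmoothOn Z Set.univ →
    ∀ x ∈ U, D.hess X Y Z x = 0

/-- The subspace of `T_x M` spanned by the values at `x` of the solutions of `∇²X = 0` that are
defined on some open neighbourhood of `x`. -/
def Connection.solSpan (D : Connection m M) (x : M) : Submodule ℝ (TangentSpace (model m) x) :=
  Submodule.span ℝ {v | ∃ (U : Set M) (X : VField m M),
    IsOpen U ∧ x ∈ U ∧ D.IsSolutionOn X U ∧ X x = v}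

/-- `r^b(∇)`: the minimum over `x` of the dimension of `D.solSpan x`. -/
def Connection.rb (D : Connection m M) : ℕ :=
  ⨅ x : M, Module.finrank ℝ (D.solSpan x)

/-- `r^b(∇) ≤ dim M`, so that the natural number `m - D.rb` is the honest difference. -/
theorem Connection.rb_le (D : Connection m M) : D.rb ≤ m := by
  rcases isEmpty_or_nonempty M with h | ⟨⟨x⟩⟩
  · simp [Connection.rb]
  · refine (ciInf_le (OrderBot.bddBelow _) x).trans ?_
    have : FiniteDimensional ℝ (TangentSpace (model m) x) :=
      inferInstanceAs (FiniteDimensional ℝ (EuclideanSpace ℝ (Fin m)))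
    refine (Submodule.finrank_le _).trans (le_of_eq ?_)
    exact finrank_euclideanSpace_fin (𝕜 := ℝ) (n := m)

/-- `r^b(M)`: the minimum of `dim M - r^b(∇)` over all smooth torsion-free connections. It is taken
in `ℕ∞`, where an infimum of natural numbers over a nonempty family is its (finite) minimum, and
would be `⊤`, not a junk `0`, over an empty one. -/
def rbManifold (m : ℕ) (M : Type*) [TopologicalSpace M]
    [ChartedSpace (EuclideanSpace ℝ (Fin m)) M] [IsManifold (model m) ∞ M] : ℕ∞ :=
  ⨅ D : {D : Connection m M // D.IsSymmetric}, ((m - D.1.rb : ℕ) : ℕ∞)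

end LocallyFlat

end

/-!
The Ricci identity for a torsion-free connection reads `R(Y, Z)X = ∇²X(Y, Z) - ∇²X(Z, Y)`, so the
curvature kills every solution of `∇²X = 0`; being a tensor, it vanishes when these solutions span
the tangent spaces. Conversely, flatness is the integrability condition of the system `df = -Γ f`
for the parallel vector fields, which are solutions of `∇²X = 0`. To solve a linear total
differential system `df = A f` with initial value `w` at `y₀`, let `f y` be the value at `y` of the
solution of the ordinary differential equation along the segment from `y₀` to `y` starting at `w`.
By integrability, `v + t A(y₀ + t (y - y₀))(z - y) v` with `v` the solution towards `y` solves the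
equation towards `z` up to `o(z - y)`, so that Grönwall's inequality gives the derivative of `f`.
-/

set_option maxSynthPendingDepth 3

noncomputable section

namespace LocallyFlat

section LinearODE

open Set Metric
open scoped NNReal

variable {F : Type*} [NormedAddCommGroup F] [NormedSpace ℝ F] {B : ℝ → F →L[ℝ] F} {a b : ℝ}
  {c : ℝ≥0}

theorem exists_isIntegralCurveOn_of_mul_lt_one [CompleteSpace F] (hab : a ≤ b)
    (hB : ContinuousOn B (Icc a b)) (hc : ∀ t ∈ Icc a b, ‖B t‖ ≤ c) (hcab : c * (b - a) < 1)
    (w : F) : ∃ α : ℝ → F, α a = w ∧ IsIntegralCurveOn α (fun t v ↦ B t v) (Icc a b) := by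
  -- The fixed point of `ρ ↦ c (‖w‖ + ρ) (b - a)`: no solution leaves the ball of radius `ρ`.
  obtain ⟨ρ, hρ⟩ : ∃ ρ : ℝ≥0, c * (‖w‖ + ρ) * (b - a) = ρ := by
    refine ⟨.mk (c * (b - a) * ‖w‖ / (1 - c * (b - a))) ?_, ?_⟩
    · have := sub_nonneg.2 hab
      have := (sub_pos.2 hcab).le
      positivity
    · have := (sub_pos.2 hcab).ne'
      rw [NNReal.coe_mk]
      field_simp
      ring
  have picardLindelof : IsPicardLindelof (fun t v ↦ B t v)
      (⟨a, left_mem_Icc.2 hab⟩ : Icc a b) w ρ 0 (c * (‖w‖₊ + ρ)) c :=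
    { lipschitzOnWith := fun t ht ↦ ((B t).lipschitz.weaken (hc t ht)).lipschitzOnWith
      continuousOn := fun v _ ↦ hB.clm_apply continuousOn_const
      norm_le := fun t ht v hv ↦
        (B t).le_of_opNorm_le_of_le (hc t ht) (norm_le_of_mem_closedBall hv)
      mul_max_le := by simp [sub_nonneg.2 hab, hρ] }
  exact picardLindelof.exists_eq_forall_mem_Icc_hasDerivWithinAt₀

theorem gronwallBound_zero_eq_mul (K ε x : ℝ) :
    gronwallBound 0 K ε x = ε * gronwallBound 0 K 1 x := by
  simp only [gronwallBound]
  split_ifs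
  · simp
  · ring

theorem norm_sub_le_of_isIntegralCurveOn {α g g' : ℝ → F} {ε : ℝ}
    (hc : ∀ t ∈ Icc a b, ‖B t‖ ≤ c) (hα : IsIntegralCurveOn α (fun t v ↦ B t v) (Icc a b))
    (hg : ∀ t ∈ Icc a b, HasDerivWithinAt g (g' t) (Icc a b) t)
    (hε : ∀ t ∈ Icc a b, ‖g' t - B t (g t)‖ ≤ ε) (ha : α a = g a) {t : ℝ} (ht : t ∈ Icc a b) :
    ‖α t - g t‖ ≤ ε * gronwallBound 0 c 1 (t - a) := by
  have rightDeriv {f : ℝ → F} {f' : F} {t : ℝ} (ht : t ∈ Ico a b)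
      (h : HasDerivWithinAt f f' (Icc a b) t) : HasDerivWithinAt f f' (Ici t) t :=
    h.mono_of_mem_nhdsWithin (Filter.mem_of_superset (Icc_mem_nhdsGE ht.2)
      (Icc_subset_Icc_left ht.1))
  have gronwall := dist_le_of_approx_trajectories_ODE_of_mem (v := fun t v ↦ B t v)
    (s := fun _ ↦ univ) (K := c) (f' := fun t ↦ B t (α t)) (εf := 0) (δ := 0)
    (fun t ht ↦ ((B t).lipschitz.weaken (hc t (Ico_subset_Icc_self ht))).lipschitzOnWith)
    hα.continuousOn (fun t ht ↦ rightDeriv ht (hα t (Ico_subset_Icc_self ht)))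
    (by simp) (by simp)
    (fun t ht ↦ (hg t ht).continuousWithinAt)
    (fun t ht ↦ rightDeriv ht (hg t (Ico_subset_Icc_self ht)))
    (fun t ht ↦ (dist_eq_norm _ _).trans_le (hε t (Ico_subset_Icc_self ht)))
    (by simp) (by simp [ha]) t ht
  rwa [dist_eq_norm, zero_add, gronwallBound_zero_eq_mul] at gronwall

end LinearODE

section UniformTaylor

open Filter

variable {E F P : Type*} [NormedAddCommGroup E] [NormedSpace ℝ E] [NormedAddCommGroup F]
  [NormedSpace ℝ F] [NormedAddCommGroup P] [NormedSpace ℝ P]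

theorem eventually_forall_norm_sub_sub_fderiv_le {Φ : E × P → F} {y : E} {K : Set P}
    (hK : IsCompact K) (hΦ : ∀ p ∈ K, ContDiffAt ℝ 1 Φ (y, p)) {ε : ℝ} (hε : 0 < ε) :
    ∀ᶠ z in 𝓝 y, ∀ p ∈ K,
      ‖Φ (z, p) - Φ (y, p) - fderiv ℝ Φ (y, p) (z - y, 0)‖ ≤ ε * ‖z - y‖ := by
  refine hK.eventually_forall_of_forall_eventually
    (P := fun z p ↦ ‖Φ (z, p) - Φ (y, p) - fderiv ℝ Φ (y, p) (z - y, 0)‖ ≤ ε * ‖z - y‖)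
    fun p₀ hp₀ ↦ ?_
  have strict := ((hΦ p₀ hp₀).hasStrictFDerivAt one_ne_zero).isLittleO.def (half_pos hε)
  have toPair : Tendsto (fun q : E × P ↦ (q, (y, q.2))) (𝓝 (y, p₀)) (𝓝 ((y, p₀), (y, p₀))) :=
    Continuous.tendsto' (by fun_prop) _ _ rfl
  have derivNear : ∀ᶠ q : E × P in 𝓝 (y, p₀),
      ‖fderiv ℝ Φ (y, q.2) - fderiv ℝ Φ (y, p₀)‖ ≤ ε / 2 := by
    have hcont : ContinuousAt (fun q : E × P ↦ fderiv ℝ Φ (y, q.2)) (y, p₀) :=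
      ((hΦ p₀ hp₀).continuousAt_fderiv one_ne_zero).comp_of_eq (by fun_prop) rfl
    filter_upwards [hcont.eventually_mem (Metric.closedBall_mem_nhds _ (half_pos hε))] with q hq
    simpa [dist_eq_norm] using hq
  filter_upwards [toPair.eventually strict, derivNear] with ⟨z, p⟩ hz hp
  have hpair : ((z, p) : E × P) - (y, p) = (z - y, 0) := by simp
  have hnorm : ‖((z - y, 0) : E × P)‖ = ‖z - y‖ := by simp [Prod.norm_def]
  rw [hpair, hnorm] at hz
  have hp' := ContinuousLinearMap.le_of_opNorm_le _ hp (z - y, 0)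
  rw [hnorm, sub_apply] at hp'
  calc ‖Φ (z, p) - Φ (y, p) - fderiv ℝ Φ (y, p) (z - y, 0)‖
      = ‖(Φ (z, p) - Φ (y, p) - fderiv ℝ Φ (y, p₀) (z - y, 0))
          - (fderiv ℝ Φ (y, p) (z - y, 0) - fderiv ℝ Φ (y, p₀) (z - y, 0))‖ := by
        congr 1; abel
    _ ≤ ε / 2 * ‖z - y‖ + ε / 2 * ‖z - y‖ := (norm_sub_le _ _).trans (add_le_add hz hp')
    _ = ε * ‖z - y‖ := by ring

end UniformTaylor

section TotalDifferential

open Set Metric Filter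
open scoped NNReal

variable {E F : Type*} [NormedAddCommGroup E] [NormedSpace ℝ E] [NormedAddCommGroup F]
  [NormedSpace ℝ F] {A : E → E →L[ℝ] F →L[ℝ] F} {s : Set E} {y₀ y z : E}

/-- The integrability condition for the linear total differential system `df = A f` on `s`, that
is, `D f(y) u = A(y) u (f y)`: it says that the second derivative of a solution would be symmetric,
equivalently that the connection `d - A` is flat. -/
def IsFlatOn (A : E → E →L[ℝ] F →L[ℝ] F) (s : Set E) : Prop :=
  ∀ y ∈ s, ∀ (u v : E) (w : F),
    fderiv ℝ A y u v w + A y v (A y u w) = fderiv ℝ A y v u w + A y u (A y v w)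

/-- The coefficient of the linear differential equation which the system `df = A f` induces on the
segment from `y₀` to `y`, parametrised by `[0, 1]`. -/
def radialCoeff (A : E → E →L[ℝ] F →L[ℝ] F) (y₀ y : E) (t : ℝ) : F →L[ℝ] F :=
  A (y₀ + t • (y - y₀)) (y - y₀)

theorem continuousOn_radialCoeff (hs : StarConvex ℝ y₀ s) (hA : ContinuousOn A s) (hy : y ∈ s) :
    ContinuousOn (radialCoeff A y₀ y) (Icc 0 1) :=
  (hA.comp (by fun_prop) fun _ ht ↦ hs.add_smul_sub_mem hy ht.1 ht.2).clm_apply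
    continuousOn_const

theorem exists_eventually_forall_norm_radialCoeff_le (hs : StarConvex ℝ y₀ s) (hso : IsOpen s)
    (hA : ContinuousOn A s) (hy : y ∈ s) :
    ∃ c : ℝ≥0, ∀ᶠ z in 𝓝 y, ∀ t ∈ Icc (0 : ℝ) 1, ‖radialCoeff A y₀ z t‖ ≤ c := by
  obtain ⟨c, hc⟩ := isCompact_Icc.exists_bound_of_continuousOn (continuousOn_radialCoeff hs hA hy)
  refine ⟨(c + 1).toNNReal, isCompact_Icc.eventually_forall_of_forall_eventually
    (P := fun z t ↦ ‖radialCoeff A y₀ z t‖ ≤ (c + 1).toNNReal) fun t ht ↦ ?_⟩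
  have hcont : ContinuousAt (fun q : E × ℝ ↦ radialCoeff A y₀ q.1 q.2) (y, t) :=
    ContinuousAt.clm_apply (ContinuousAt.comp (g := A)
      (hA.continuousAt (hso.mem_nhds (hs.add_smul_sub_mem hy ht.1 ht.2))) (by fun_prop))
      (by fun_prop)
  filter_upwards [hcont.norm.eventually_lt_const ((hc t ht).trans_lt (lt_add_one c))] with q hq
  exact hq.le.trans (Real.le_coe_toNNReal _)

theorem exists_ball_forall_exists_radial_solution [CompleteSpace F] (hso : IsOpen s)
    (hA : ContinuousOn A s) (hy₀ : y₀ ∈ s) :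
    ∃ r > 0, ball y₀ r ⊆ s ∧ ∀ y ∈ ball y₀ r, ∀ w : F, ∃ α : ℝ → F, α 0 = w ∧
      IsIntegralCurveOn α (fun t v ↦ radialCoeff A y₀ y t v) (Icc 0 1) := by
  obtain ⟨ρ, hρ, hρs⟩ := Metric.mem_nhds_iff.1 (inter_mem (hso.mem_nhds hy₀)
    ((hA.continuousAt (hso.mem_nhds hy₀)).nnnorm.eventually_lt_const (lt_add_one ‖A y₀‖₊)))
  set C : ℝ≥0 := ‖A y₀‖₊ + 1
  have hC : 0 < C := by positivity
  have hrρ : ball y₀ (min ρ (1 / C)) ⊆ ball y₀ ρ := ball_subset_ball (min_le_left _ _)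
  refine ⟨min ρ (1 / C), by positivity, fun y hy ↦ (hρs (hrρ hy)).1, fun y hy w ↦ ?_⟩
  have hstar : StarConvex ℝ y₀ (ball y₀ ρ) := (convex_ball y₀ ρ).starConvex (mem_ball_self hρ)
  refine exists_isIntegralCurveOn_of_mul_lt_one (c := C * ‖y - y₀‖₊) zero_le_one
    (continuousOn_radialCoeff hstar (hA.mono fun y hy ↦ (hρs hy).1) (hrρ hy))
    (fun t ht ↦ ?_) ?_ w
  · exact (A _).le_of_opNorm_le (hρs (hstar.add_smul_sub_mem (hrρ hy) ht.1 ht.2)).2.le _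
  · have hlt : ‖y - y₀‖ < 1 / C := (mem_ball_iff_norm.1 hy).trans_le (min_le_right _ _)
    rw [lt_div_iff₀' (by exact_mod_cast hC)] at hlt
    simpa using hlt

/-- The candidate, to first order in `z - y`, for the value at time `t` of the radial solution
towards `z`, where `v` is the value of the radial solution towards `y`: it is what a solution of
`df = A f` would satisfy. -/
def radialVariation (A : E → E →L[ℝ] F →L[ℝ] F) (y₀ y z : E) (t : ℝ) (v : F) : F :=
  v + t • A (y₀ + t • (y - y₀)) (z - y) v

theorem contDiffAt_radialCoeff_radialVariation {t : ℝ} {n : WithTop ℕ∞}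
    (hA : ContDiffAt ℝ n A (y₀ + t • (y - y₀))) (v : F) :
    ContDiffAt ℝ n (fun q : E × ℝ × F ↦
      radialCoeff A y₀ q.1 q.2.1 (radialVariation A y₀ y q.1 q.2.1 q.2.2)) (y, t, v) := by
  have hz : ContDiffAt ℝ n (fun q : E × ℝ × F ↦ A (y₀ + q.2.1 • (q.1 - y₀))) (y, t, v) :=
    ContDiffAt.comp (g := A) _ hA (by fun_prop)
  have hy : ContDiffAt ℝ n (fun q : E × ℝ × F ↦ A (y₀ + q.2.1 • (y - y₀))) (y, t, v) :=
    ContDiffAt.comp (g := A) _ hA (by fun_prop)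
  have hvar : ContDiffAt ℝ n (fun q : E × ℝ × F ↦ radialVariation A y₀ y q.1 q.2.1 q.2.2)
      (y, t, v) :=
    ContDiffAt.add (by fun_prop) (ContDiffAt.smul (by fun_prop)
      ((hy.clm_apply (by fun_prop)).clm_apply (by fun_prop)))
  exact (hz.clm_apply (by fun_prop)).clm_apply hvar

theorem fderiv_radialCoeff_radialVariation_apply {t : ℝ}
    (hA : ContDiffAt ℝ 1 A (y₀ + t • (y - y₀))) (v : F) (h : E) :
    fderiv ℝ (fun q : E × ℝ × F ↦
        radialCoeff A y₀ q.1 q.2.1 (radialVariation A y₀ y q.1 q.2.1 q.2.2)) (y, t, v) (h, 0) =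
      t • fderiv ℝ A (y₀ + t • (y - y₀)) h (y - y₀) v + A (y₀ + t • (y - y₀)) h v
        + t • A (y₀ + t • (y - y₀)) (y - y₀) (A (y₀ + t • (y - y₀)) h v) := by
  have hline : HasDerivAt (fun r : ℝ ↦ y + r • h) h 0 := by
    simpa using ((hasDerivAt_id (0 : ℝ)).smul_const h).const_add y
  have hpair : HasDerivAt (fun r : ℝ ↦ (y + r • h, t, v)) (h, 0) 0 :=
    hline.prodMk (hasDerivAt_const _ _)
  have hleft := (((contDiffAt_radialCoeff_radialVariation hA v).differentiableAt
    one_ne_zero).hasFDerivAt.comp_hasDerivAt_of_eq (0 : ℝ) hpair (by simp))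
  refine hleft.unique ?_
  have hseg : HasDerivAt (fun r : ℝ ↦ y₀ + t • (y + r • h - y₀)) (t • h) 0 :=
    ((hline.sub_const y₀).const_smul t).const_add y₀
  have hcoeff : HasDerivAt (fun r : ℝ ↦ A (y₀ + t • (y + r • h - y₀)))
      (fderiv ℝ A (y₀ + t • (y - y₀)) (t • h)) 0 :=
    (hA.differentiableAt one_ne_zero).hasFDerivAt.comp_hasDerivAt_of_eq (0 : ℝ) hseg (by simp)
  have hvar : HasDerivAt (fun r : ℝ ↦ radialVariation A y₀ y (y + r • h) t v)
      (t • A (y₀ + t • (y - y₀)) h v) 0 := by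
    have : HasDerivAt (fun r : ℝ ↦ v + t • r • A (y₀ + t • (y - y₀)) h v)
        (t • A (y₀ + t • (y - y₀)) h v) 0 := by
      simpa using (((hasDerivAt_id (0 : ℝ)).smul_const
        (A (y₀ + t • (y - y₀)) h v)).const_smul t).const_add v
    simpa [radialVariation] using this
  refine ((hcoeff.clm_apply (hline.sub_const y₀)).clm_apply hvar).congr_deriv ?_
  simp [radialVariation]

theorem hasDerivWithinAt_radialVariation {α : ℝ → F} {α' : F} {t : ℝ} {I : Set ℝ}
    (hA : DifferentiableAt ℝ A (y₀ + t • (y - y₀))) (hα : HasDerivWithinAt α α' I t) (z : E) :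
    HasDerivWithinAt (fun t ↦ radialVariation A y₀ y z t (α t))
      (α' + (t • (fderiv ℝ A (y₀ + t • (y - y₀)) (y - y₀) (z - y) (α t)
        + A (y₀ + t • (y - y₀)) (z - y) α') + A (y₀ + t • (y - y₀)) (z - y) (α t))) I t := by
  have hseg : HasDerivAt (fun t : ℝ ↦ y₀ + t • (y - y₀)) (y - y₀) t := by
    simpa using ((hasDerivAt_id t).smul_const (y - y₀)).const_add y₀
  have hcoeff : HasDerivAt (fun t : ℝ ↦ A (y₀ + t • (y - y₀)))
      (fderiv ℝ A (y₀ + t • (y - y₀)) (y - y₀)) t :=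
    HasFDerivAt.comp_hasDerivAt (l := A) t hA.hasFDerivAt hseg
  have hterm := (hasDerivWithinAt_id t I).fun_smul
    ((hcoeff.clm_apply (hasDerivAt_const t (z - y))).hasDerivWithinAt.clm_apply hα)
  exact (hα.fun_add hterm).congr_deriv (by simp)

theorem IsFlatOn.eventually_radialVariation_defect_le (hs : StarConvex ℝ y₀ s) (hso : IsOpen s)
    (hA : ContDiffOn ℝ 1 A s) (hflat : IsFlatOn A s) (hy : y ∈ s) {α : ℝ → F}
    (hα : IsIntegralCurveOn α (fun t v ↦ radialCoeff A y₀ y t v) (Icc 0 1)) {ε : ℝ} (hε : 0 < ε) :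
    ∀ᶠ z in 𝓝 y, ∃ g' : ℝ → F, ∀ t ∈ Icc (0 : ℝ) 1,
      HasDerivWithinAt (fun t ↦ radialVariation A y₀ y z t (α t)) (g' t) (Icc 0 1) t ∧
        ‖g' t - radialCoeff A y₀ z t (radialVariation A y₀ y z t (α t))‖ ≤ ε * ‖z - y‖ := by
  have hAt (t) (ht : t ∈ Icc (0 : ℝ) 1) : ContDiffAt ℝ 1 A (y₀ + t • (y - y₀)) :=
    hA.contDiffAt (hso.mem_nhds (hs.add_smul_sub_mem hy ht.1 ht.2))
  have hgraph : IsCompact ((fun t ↦ (t, α t)) '' Icc (0 : ℝ) 1) :=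
    isCompact_Icc.image_of_continuousOn (continuousOn_id.prodMk hα.continuousOn)
  have taylor := eventually_forall_norm_sub_sub_fderiv_le hgraph (y := y)
    (forall_mem_image.2 fun t ht ↦ contDiffAt_radialCoeff_radialVariation (hAt t ht) (α t)) hε
  filter_upwards [taylor] with z hz
  refine ⟨_, fun t ht ↦ ⟨hasDerivWithinAt_radialVariation
    ((hAt t ht).differentiableAt one_ne_zero) (hα t ht) z, ?_⟩⟩
  have hzt := forall_mem_image.1 hz ht
  rw [fderiv_radialCoeff_radialVariation_apply (hAt t ht), sub_sub, norm_sub_rev] at hzt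
  -- Flatness says exactly that the variation solves the linearised radial equation.
  have hflat_t := hflat _ (hs.add_smul_sub_mem hy ht.1 ht.2) (y - y₀) (z - y) (α t)
  refine (congrArg (‖· - _‖) ?_).trans_le hzt
  simp only [radialCoeff, radialVariation, sub_self, map_zero, zero_apply, smul_zero, add_zero,
    hflat_t, smul_add]
  abel

theorem hasFDerivAt_radial_solution (hs : StarConvex ℝ y₀ s) (hso : IsOpen s)
    (hA : ContDiffOn ℝ 1 A s) (hflat : IsFlatOn A s) {α : E → ℝ → F} {w : F}
    (hα₀ : ∀ z ∈ s, α z 0 = w)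
    (hα : ∀ z ∈ s, IsIntegralCurveOn (α z) (fun t v ↦ radialCoeff A y₀ z t v) (Icc 0 1))
    (hy : y ∈ s) : HasFDerivAt (fun z ↦ α z 1) ((A y).flip (α y 1)) y := by
  obtain ⟨c, hc⟩ := exists_eventually_forall_norm_radialCoeff_le hs hso hA.continuousOn hy
  rw [hasFDerivAt_iff_isLittleO]
  have hG : 0 < |gronwallBound 0 c 1 1| + 1 := by positivity
  refine Asymptotics.IsLittleO.of_bound fun ε hε ↦ ?_
  filter_upwards [hso.mem_nhds hy, hc, hflat.eventually_radialVariation_defect_le hs hso hA hy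
    (hα y hy) (div_pos hε hG)] with z hz hcz ⟨g', hg'⟩
  have gronwall := norm_sub_le_of_isIntegralCurveOn hcz (hα z hz) (fun t ht ↦ (hg' t ht).1)
    (fun t ht ↦ (hg' t ht).2) (by simp [radialVariation, hα₀ z hz, hα₀ y hy])
    (right_mem_Icc.2 zero_le_one)
  calc ‖α z 1 - α y 1 - (A y).flip (α y 1) (z - y)‖
      = ‖α z 1 - radialVariation A y₀ y z 1 (α y 1)‖ := by simp [radialVariation, sub_sub]
    _ ≤ ε / (|gronwallBound 0 c 1 1| + 1) * ‖z - y‖ * gronwallBound 0 c 1 1 := by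
        simpa using gronwall
    _ ≤ ε / (|gronwallBound 0 c 1 1| + 1) * ‖z - y‖ * (|gronwallBound 0 c 1 1| + 1) := by
        gcongr; exact (le_abs_self _).trans (lt_add_one _).le
    _ = ε * ‖z - y‖ := by field_simp

theorem exists_forall_hasFDerivAt_of_isFlatOn [CompleteSpace F] (hso : IsOpen s)
    (hA : ContDiffOn ℝ 1 A s) (hflat : IsFlatOn A s) (hy₀ : y₀ ∈ s) :
    ∃ r > 0, ball y₀ r ⊆ s ∧ ∀ w : F, ∃ f : E → F, f y₀ = w ∧
      ∀ y ∈ ball y₀ r, HasFDerivAt f ((A y).flip (f y)) y := by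
  obtain ⟨r, hr, hrs, hex⟩ := exists_ball_forall_exists_radial_solution hso hA.continuousOn hy₀
  refine ⟨r, hr, hrs, fun w ↦ ?_⟩
  choose! α hα₀ hα using fun y hy ↦ hex y hy w
  refine ⟨fun y ↦ α y 1, ?_, fun y hy ↦ hasFDerivAt_radial_solution
    ((convex_ball y₀ r).starConvex (mem_ball_self hr)) isOpen_ball (hA.mono hrs)
    (fun y hy ↦ hflat y (hrs hy)) hα₀ hα hy⟩
  have hconst : ∀ t ∈ Icc (0 : ℝ) 1, HasDerivWithinAt (α y₀) 0 (Icc 0 1) t := fun t ht ↦ by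
    simpa [radialCoeff] using hα y₀ (mem_ball_self hr) t ht
  rw [← hα₀ y₀ (mem_ball_self hr)]
  exact constant_of_derivWithin_zero (fun t ht ↦ (hconst t ht).differentiableWithinAt)
    (fun t ht ↦ (hconst t (Ico_subset_Icc_self ht)).derivWithin
      (uniqueDiffOn_Icc zero_lt_one t (Ico_subset_Icc_self ht))) 1 (right_mem_Icc.2 zero_le_one)

theorem contDiffOn_of_hasFDerivAt_flip (hso : IsOpen s) {f : E → F}
    (hf : ∀ y ∈ s, HasFDerivAt f ((A y).flip (f y)) y) {n : ℕ} (hA : ContDiffOn ℝ n A s) :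
    ContDiffOn ℝ (n + 1) f s := by
  have bootstrap {k : ℕ} (hk : k ≤ n) (hfk : ContDiffOn ℝ k f s) : ContDiffOn ℝ (k + 1) f s := by
    rw [contDiffOn_succ_iff_fderiv_of_isOpen hso]
    refine ⟨fun y hy ↦ (hf y hy).differentiableAt.differentiableWithinAt, by simp, ?_⟩
    have hflip : ContDiffOn ℝ k (fun y ↦ (A y).flip) s :=
      (ContinuousLinearMap.flipₗᵢ ℝ E F F).contDiff.comp_contDiffOn
        (hA.of_le (Nat.cast_le.2 hk))
    exact (hflip.clm_apply hfk).congr fun y hy ↦ (hf y hy).fderiv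
  suffices ∀ k ≤ n + 1, ContDiffOn ℝ k f s from mod_cast this (n + 1) le_rfl
  intro k hk
  induction k with
  | zero => exact contDiffOn_zero.2 fun y hy ↦ (hf y hy).continuousAt.continuousWithinAt
  | succ k ih => exact_mod_cast bootstrap (Nat.succ_le_succ_iff.1 hk) (ih (by lia))

theorem contDiffOn_infty_of_hasFDerivAt_flip (hso : IsOpen s) {f : E → F}
    (hf : ∀ y ∈ s, HasFDerivAt f ((A y).flip (f y)) y) (hA : ContDiffOn ℝ ∞ A s) :
    ContDiffOn ℝ ∞ f s :=
  contDiffOn_infty.2 fun n ↦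
    (contDiffOn_of_hasFDerivAt_flip hso hf (contDiffOn_infty.1 hA n)).of_le (by simp)

end TotalDifferential

section Calculus

variable {E : Type*} [NormedAddCommGroup E] [NormedSpace ℝ E] {Γ : E → E →L[ℝ] E →L[ℝ] E}
  {X Y Z : E → E} {y : E}

/-- The covariant derivative `∇_X Y` on a vector space of the connection with Christoffel symbols
`Γ`; the first argument of `Γ y` is the direction of differentiation. -/
def coordNabla (Γ : E → E →L[ℝ] E →L[ℝ] E) (X Y : E → E) : E → E :=
  fun y ↦ fderiv ℝ Y y (X y) + Γ y (X y) (Y y)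

/-- The curvature `R(u, v)` at `y`, as an endomorphism, of the connection on a vector space with
Christoffel symbols `Γ`. -/
def coordCurv (Γ : E → E →L[ℝ] E →L[ℝ] E) (y u v : E) : E →L[ℝ] E :=
  fderiv ℝ Γ y u v - fderiv ℝ Γ y v u + (Γ y u ∘L Γ y v - Γ y v ∘L Γ y u)

theorem fderiv_coordNabla_apply (hΓ : DifferentiableAt ℝ Γ y) (hX : DifferentiableAt ℝ X y)
    (hY : ContDiffAt ℝ 2 Y y) (u : E) :
    fderiv ℝ (coordNabla Γ X Y) y u =
      fderiv ℝ (fderiv ℝ Y) y u (X y) + fderiv ℝ Y y (fderiv ℝ X y u) +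
        (fderiv ℝ Γ y u (X y) (Y y) + Γ y (fderiv ℝ X y u) (Y y) +
          Γ y (X y) (fderiv ℝ Y y u)) := by
  have hY' := (hY.differentiableAt (by simp)).hasFDerivAt
  have hY'' := ((hY.fderiv_right (m := 1) (by norm_cast)).differentiableAt (by simp)).hasFDerivAt
  have h : HasFDerivAt (coordNabla Γ X Y) _ y :=
    (hY''.clm_apply hX.hasFDerivAt).add
      ((hΓ.hasFDerivAt.clm_apply hX.hasFDerivAt).clm_apply hY')
  rw [h.fderiv]
  simp only [ContinuousLinearMap.flip_add, add_apply, ContinuousLinearMap.comp_apply,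
    ContinuousLinearMap.flip_apply]
  abel

theorem coordNabla_coordNabla_sub_coordNabla_lieBracket (hΓ : DifferentiableAt ℝ Γ y)
    (hX : DifferentiableAt ℝ X y) (hY : DifferentiableAt ℝ Y y) (hZ : ContDiffAt ℝ 2 Z y) :
    coordNabla Γ X (coordNabla Γ Y Z) y - coordNabla Γ Y (coordNabla Γ X Z) y
      - coordNabla Γ (VectorField.lieBracket ℝ X Y) Z y = coordCurv Γ y (X y) (Y y) (Z y) := by
  have hsymm : fderiv ℝ (fderiv ℝ Z) y (X y) (Y y) = fderiv ℝ (fderiv ℝ Z) y (Y y) (X y) :=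
    (hZ.isSymmSndFDerivAt (by simp)).eq _ _
  rw [coordNabla, fderiv_coordNabla_apply hΓ hY hZ, coordNabla.eq_def Γ Y (coordNabla Γ X Z),
    fderiv_coordNabla_apply hΓ hX hZ, hsymm]
  simp only [coordNabla, coordCurv, VectorField.lieBracket, map_add, map_sub, add_apply, sub_apply,
    ContinuousLinearMap.comp_apply]
  abel

end Calculus

section Charts

variable {E : Type*} [NormedAddCommGroup E] [NormedSpace ℝ E] {M : Type*} [TopologicalSpace M]
  [ChartedSpace E M]

variable (E) in
/-- The derivative at `p` of the chart at `x₀`, with values in the model space. -/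
def chartDeriv (x₀ p : M) : TangentSpace 𝓘(ℝ, E) p →L[ℝ] E :=
  mfderiv 𝓘(ℝ, E) 𝓘(ℝ, E) (extChartAt 𝓘(ℝ, E) x₀) p

/-- The expression of a vector field in the chart at `x₀`. -/
def coords (x₀ : M) (X : (p : M) → TangentSpace 𝓘(ℝ, E) p) : E → E :=
  VectorField.mpullback 𝓘(ℝ, E) 𝓘(ℝ, E) (extChartAt 𝓘(ℝ, E) x₀).symm X

/-- The vector field with a given expression in the chart at `x₀`. -/
def ofCoords (x₀ : M) (f : E → E) : (p : M) → TangentSpace 𝓘(ℝ, E) p :=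
  VectorField.mpullback 𝓘(ℝ, E) 𝓘(ℝ, E) (extChartAt 𝓘(ℝ, E) x₀) f

variable {x₀ p : M} {X Y : (p : M) → TangentSpace 𝓘(ℝ, E) p} {f : E → E}

theorem coords_add : coords x₀ (X + Y) = coords x₀ X + coords x₀ Y :=
  VectorField.mpullback_add

theorem coords_smul (g : M → ℝ) :
    coords x₀ (g • X) = (g ∘ (extChartAt 𝓘(ℝ, E) x₀).symm) • coords x₀ X :=
  funext fun y ↦ map_smul (mfderiv 𝓘(ℝ, E) 𝓘(ℝ, E) (extChartAt 𝓘(ℝ, E) x₀).symm y).inverse _ _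

theorem ofCoords_apply :
    ofCoords x₀ f p = (chartDeriv E x₀ p).inverse (f (extChartAt 𝓘(ℝ, E) x₀ p)) :=
  rfl

theorem eventually_of_eventually_extChartAt (hp : p ∈ (extChartAt 𝓘(ℝ, E) x₀).source)
    {P : E → Prop} (h : ∀ᶠ q in 𝓝 p, P (extChartAt 𝓘(ℝ, E) x₀ q)) :
    ∀ᶠ y in 𝓝 (extChartAt 𝓘(ℝ, E) x₀ p), P y := by
  have hmap := map_extChartAt_nhds' (I := 𝓘(ℝ, E)) hp
  rw [modelWithCornersSelf_coe, Set.range_id, nhdsWithin_univ] at hmap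
  rwa [← hmap, Filter.eventually_map]

variable [IsManifold 𝓘(ℝ, E) 1 M]

theorem mdifferentiableAt_extChartAt_symm (hp : p ∈ (extChartAt 𝓘(ℝ, E) x₀).source) :
    MDifferentiableAt 𝓘(ℝ, E) 𝓘(ℝ, E) (extChartAt 𝓘(ℝ, E) x₀).symm
      (extChartAt 𝓘(ℝ, E) x₀ p) := by
  have h := mdifferentiableWithinAt_extChartAt_symm ((extChartAt 𝓘(ℝ, E) x₀).map_source hp)
  rwa [modelWithCornersSelf_coe, Set.range_id, mdifferentiableWithinAt_univ] at h

theorem isInvertible_chartDeriv (hp : p ∈ (extChartAt 𝓘(ℝ, E) x₀).source) :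
    (chartDeriv E x₀ p).IsInvertible :=
  isInvertible_mfderiv_extChartAt hp

theorem isInvertible_mfderiv_extChartAt_symm (hp : p ∈ (extChartAt 𝓘(ℝ, E) x₀).source) :
    (mfderiv 𝓘(ℝ, E) 𝓘(ℝ, E) (extChartAt 𝓘(ℝ, E) x₀).symm
      (extChartAt 𝓘(ℝ, E) x₀ p)).IsInvertible := by
  have h := isInvertible_mfderivWithin_extChartAt_symm (I := 𝓘(ℝ, E))
    ((extChartAt 𝓘(ℝ, E) x₀).map_source hp)
  rwa [modelWithCornersSelf_coe, Set.range_id, mfderivWithin_univ] at h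

theorem chartDeriv_inverse_apply (hp : p ∈ (extChartAt 𝓘(ℝ, E) x₀).source) (w : E) :
    chartDeriv E x₀ p ((chartDeriv E x₀ p).inverse w) = w :=
  (isInvertible_chartDeriv hp).self_apply_inverse w

theorem coords_extChartAt (hp : p ∈ (extChartAt 𝓘(ℝ, E) x₀).source)
    (X : (p : M) → TangentSpace 𝓘(ℝ, E) p) :
    coords x₀ X (extChartAt 𝓘(ℝ, E) x₀ p) = chartDeriv E x₀ p (X p) := by
  have hy := (extChartAt 𝓘(ℝ, E) x₀).map_source hp
  have hinv := ContinuousLinearMap.inverse_eq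
    (mfderivWithin_extChartAt_symm_comp_mfderiv_extChartAt (I := 𝓘(ℝ, E)) hy)
    (mfderiv_extChartAt_comp_mfderivWithin_extChartAt_symm hy)
  rw [modelWithCornersSelf_coe, Set.range_id, mfderivWithin_univ] at hinv
  rw [coords, VectorField.mpullback_apply, hinv, (extChartAt 𝓘(ℝ, E) x₀).left_inv hp]
  rfl

theorem coords_ofCoords (hp : p ∈ (extChartAt 𝓘(ℝ, E) x₀).source) :
    coords x₀ (ofCoords x₀ f : (p : M) → TangentSpace 𝓘(ℝ, E) p) (extChartAt 𝓘(ℝ, E) x₀ p) =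
      f (extChartAt 𝓘(ℝ, E) x₀ p) := by
  rw [coords_extChartAt hp, ofCoords_apply, chartDeriv_inverse_apply hp]

theorem coords_ofCoords_eventuallyEq (hp : p ∈ (extChartAt 𝓘(ℝ, E) x₀).source) :
    coords x₀ (ofCoords x₀ f : (p : M) → TangentSpace 𝓘(ℝ, E) p)
      =ᶠ[𝓝 (extChartAt 𝓘(ℝ, E) x₀ p)] f :=
  eventually_of_eventually_extChartAt hp <| by
    filter_upwards [extChartAt_source_mem_nhds' hp] with q hq
    exact coords_ofCoords hq

theorem mdifferentiableAt_comp_extChartAt_symm {g : M → ℝ}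
    (hp : p ∈ (extChartAt 𝓘(ℝ, E) x₀).source) (hg : MDifferentiableAt 𝓘(ℝ, E) 𝓘(ℝ, ℝ) g p) :
    MDifferentiableAt 𝓘(ℝ, E) 𝓘(ℝ, ℝ) (g ∘ (extChartAt 𝓘(ℝ, E) x₀).symm)
      (extChartAt 𝓘(ℝ, E) x₀ p) := by
  refine MDifferentiableAt.comp _ ?_ (mdifferentiableAt_extChartAt_symm hp)
  rwa [(extChartAt 𝓘(ℝ, E) x₀).left_inv hp]

theorem fderiv_comp_extChartAt_symm_apply {g : M → ℝ} (hp : p ∈ (extChartAt 𝓘(ℝ, E) x₀).source)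
    (hg : MDifferentiableAt 𝓘(ℝ, E) 𝓘(ℝ, ℝ) g p) (v : TangentSpace 𝓘(ℝ, E) p) :
    fderiv ℝ (g ∘ (extChartAt 𝓘(ℝ, E) x₀).symm) (extChartAt 𝓘(ℝ, E) x₀ p) (chartDeriv E x₀ p v) =
      mvfderiv 𝓘(ℝ, E) g p v := by
  have hφ : MDifferentiableAt 𝓘(ℝ, E) 𝓘(ℝ, E) (extChartAt 𝓘(ℝ, E) x₀) p :=
    mdifferentiableAt_extChartAt (by simpa using hp)
  have hgφ : g =ᶠ[𝓝 p] (g ∘ (extChartAt 𝓘(ℝ, E) x₀).symm) ∘ extChartAt 𝓘(ℝ, E) x₀ := by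
    filter_upwards [extChartAt_source_mem_nhds' hp] with q hq
    simp only [Function.comp_apply, (extChartAt 𝓘(ℝ, E) x₀).left_inv hq]
  have h := ((mdifferentiableAt_comp_extChartAt_symm hp hg).hasMFDerivAt.comp p
    hφ.hasMFDerivAt).congr_of_eventuallyEq hgφ
  rw [mfderiv_eq_fderiv] at h
  exact (DFunLike.congr_fun h.mfderiv v).symm

end Charts

section SmoothCharts

variable {E : Type*} [NormedAddCommGroup E] [NormedSpace ℝ E] {M : Type*} [TopologicalSpace M]
  [ChartedSpace E M] [IsManifold 𝓘(ℝ, E) ∞ M] {x₀ p : M} {X Y : (p : M) → TangentSpace 𝓘(ℝ, E) p}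
  {f : E → E}

theorem contMDiffAt_extChartAt_symm (hp : p ∈ (extChartAt 𝓘(ℝ, E) x₀).source) :
    CMDiffAt ∞ (extChartAt 𝓘(ℝ, E) x₀).symm (extChartAt 𝓘(ℝ, E) x₀ p) :=
  (contMDiffOn_extChartAt_symm x₀).contMDiffAt
    (extChartAt_target_mem_nhds' ((extChartAt 𝓘(ℝ, E) x₀).map_source hp))

variable [CompleteSpace E]

theorem contDiffAt_coords (hp : p ∈ (extChartAt 𝓘(ℝ, E) x₀).source) (hX : CMDiffAt ∞ (T% X) p) :
    ContDiffAt ℝ ∞ (coords x₀ X) (extChartAt 𝓘(ℝ, E) x₀ p) := by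
  refine contMDiffAt_vectorSpace_iff_contDiffAt.1
    (ContMDiffAt.mpullback_vectorField_preimage (n := ∞) ?_ (contMDiffAt_extChartAt_symm hp)
      (isInvertible_mfderiv_extChartAt_symm hp) (by norm_cast))
  rwa [(extChartAt 𝓘(ℝ, E) x₀).left_inv hp]

theorem differentiableAt_coords (hp : p ∈ (extChartAt 𝓘(ℝ, E) x₀).source)
    (hX : MDiffAt (T% X) p) : DifferentiableAt ℝ (coords x₀ X) (extChartAt 𝓘(ℝ, E) x₀ p) := by
  rw [← (extChartAt 𝓘(ℝ, E) x₀).left_inv hp] at hX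
  have hsection := hX.mpullback_vectorField (contMDiffAt_extChartAt_symm hp)
    (isInvertible_mfderiv_extChartAt_symm hp) (by norm_cast)
  exact mdifferentiableAt_iff_differentiableAt.1 <| MDifferentiableAt.comp
    (g := fun v : TangentBundle 𝓘(ℝ, E) E ↦ v.2) _
    ((contMDiff_snd_tangentBundle_modelSpace E 𝓘(ℝ, E)).contMDiffAt.mdifferentiableAt one_ne_zero)
    hsection

theorem contMDiffAt_ofCoords (hp : p ∈ (extChartAt 𝓘(ℝ, E) x₀).source)
    (hf : ContDiffAt ℝ ∞ f (extChartAt 𝓘(ℝ, E) x₀ p)) :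
    CMDiffAt ∞ (T% (ofCoords (E := E) x₀ f)) p :=
  ContMDiffAt.mpullback_vectorField_preimage (n := ∞)
    (contMDiffAt_vectorSpace_iff_contDiffAt.2 hf) (contMDiffAt_extChartAt' (by simpa using hp))
    (isInvertible_chartDeriv (E := E) hp) (by norm_cast)

theorem chartDeriv_mlieBracket (hp : p ∈ (extChartAt 𝓘(ℝ, E) x₀).source)
    (hX : MDiffAt (T% X) p) (hY : MDiffAt (T% Y) p) :
    chartDeriv E x₀ p (VectorField.mlieBracket 𝓘(ℝ, E) X Y p) =
      VectorField.lieBracket ℝ (coords x₀ X) (coords x₀ Y) (extChartAt 𝓘(ℝ, E) x₀ p) := by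
  have : IsManifold 𝓘(ℝ, E) (minSmoothness ℝ 2) M := by
    rw [minSmoothness_of_isRCLikeNormedField]
    infer_instance
  have h := VectorField.mpullback_mlieBracket (n := ∞) (f := (extChartAt 𝓘(ℝ, E) x₀).symm)
    (V := X) (W := Y) (x₀ := extChartAt 𝓘(ℝ, E) x₀ p)
    (by rwa [(extChartAt 𝓘(ℝ, E) x₀).left_inv hp])
    (by rwa [(extChartAt 𝓘(ℝ, E) x₀).left_inv hp])
    (contMDiffAt_extChartAt_symm hp) (by rw [minSmoothness_of_isRCLikeNormedField]; norm_cast)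
  rw [← coords_extChartAt hp]
  refine Eq.trans h ?_
  rw [← VectorField.mlieBracketWithin_univ, VectorField.mlieBracketWithin_eq_lieBracketWithin]
  exact congrFun VectorField.lieBracketWithin_univ _

end SmoothCharts

section ChartConnection

variable {E : Type*} [NormedAddCommGroup E] [NormedSpace ℝ E] {M : Type*} [TopologicalSpace M]
  [ChartedSpace E M] [IsManifold 𝓘(ℝ, E) ∞ M] {x₀ p : M}
  {X : (p : M) → TangentSpace 𝓘(ℝ, E) p}

/-- The flat connection of the chart at `x₀`: it differentiates the coordinates of a vector field.
Outside of the source of the chart its values are irrelevant. -/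
def chartConnection (x₀ : M) (X : (p : M) → TangentSpace 𝓘(ℝ, E) p) (p : M) :
    TangentSpace 𝓘(ℝ, E) p →L[ℝ] TangentSpace 𝓘(ℝ, E) p :=
  (chartDeriv E x₀ p).inverse ∘L fderiv ℝ (coords x₀ X) (extChartAt 𝓘(ℝ, E) x₀ p) ∘L
    chartDeriv E x₀ p

theorem chartDeriv_chartConnection (hp : p ∈ (extChartAt 𝓘(ℝ, E) x₀).source)
    (v : TangentSpace 𝓘(ℝ, E) p) :
    chartDeriv E x₀ p (chartConnection x₀ X p v) =
      fderiv ℝ (coords x₀ X) (extChartAt 𝓘(ℝ, E) x₀ p) (chartDeriv E x₀ p v) :=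
  chartDeriv_inverse_apply hp _

variable [CompleteSpace E]

theorem isCovariantDerivativeOn_chartConnection (x₀ : M) :
    IsCovariantDerivativeOn (I := 𝓘(ℝ, E)) E (chartConnection x₀)
      (extChartAt 𝓘(ℝ, E) x₀).source where
  add {X Y p} hX hY hp := by
    ext1 v
    apply (isInvertible_chartDeriv hp).injective
    rw [add_apply, map_add, chartDeriv_chartConnection hp, chartDeriv_chartConnection hp,
      chartDeriv_chartConnection hp, coords_add,
      fderiv_add (differentiableAt_coords hp hX) (differentiableAt_coords hp hY), add_apply]
  leibniz {X g p} hX hg hp := by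
    ext1 v
    apply (isInvertible_chartDeriv hp).injective
    rw [chartDeriv_chartConnection hp, coords_smul,
      fderiv_smul (mdifferentiableAt_comp_extChartAt_symm hp hg).differentiableAt
        (differentiableAt_coords hp hX), add_apply, smul_apply,
      ContinuousLinearMap.smulRight_apply, fderiv_comp_extChartAt_symm_apply hp hg,
      Function.comp_apply, (extChartAt 𝓘(ℝ, E) x₀).left_inv hp, coords_extChartAt hp, add_apply,
      map_add, smul_apply, map_smul, chartDeriv_chartConnection hp,
      ContinuousLinearMap.smulRight_apply, map_smul]

end ChartConnection

section Christoffel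

variable {E : Type*} [NormedAddCommGroup E] [NormedSpace ℝ E] [FiniteDimensional ℝ E]
  {M : Type*} [TopologicalSpace M] [ChartedSpace E M] [IsManifold 𝓘(ℝ, E) ∞ M]
  {x₀ p : M} {U : Set M} {X Y Z : (p : M) → TangentSpace 𝓘(ℝ, E) p}

local instance : CompleteSpace E :=
  FiniteDimensional.complete ℝ E

/-- Christoffel symbols of a connection in the chart at `x₀`: the difference between the connection
and the flat connection of the chart, read in the chart. The first argument of `christoffel D x₀ y`
is the direction of differentiation. -/
def christoffel (D : CovariantDerivative 𝓘(ℝ, E) E (TangentSpace 𝓘(ℝ, E) : M → Type _)) (x₀ : M)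
    (y : E) : E →L[ℝ] E →L[ℝ] E :=
  let p := (extChartAt 𝓘(ℝ, E) x₀).symm y
  let B : E →L[ℝ] E →L[ℝ] E := IsCovariantDerivativeOn.difference D.isCovariantDerivativeOn
    (isCovariantDerivativeOn_chartConnection x₀) p
  let S : E →L[ℝ] E := (chartDeriv E x₀ p).inverse
  ((ContinuousLinearMap.compL ℝ E E E (chartDeriv E x₀ p) ∘L B).bilinearComp S S).flip

variable {D : CovariantDerivative 𝓘(ℝ, E) E (TangentSpace 𝓘(ℝ, E) : M → Type _)}

theorem christoffel_chartDeriv_chartDeriv (hp : p ∈ (extChartAt 𝓘(ℝ, E) x₀).source)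
    (v w : TangentSpace 𝓘(ℝ, E) p) :
    christoffel D x₀ (extChartAt 𝓘(ℝ, E) x₀ p) (chartDeriv E x₀ p v) (chartDeriv E x₀ p w) =
      chartDeriv E x₀ p (IsCovariantDerivativeOn.difference D.isCovariantDerivativeOn
        (isCovariantDerivativeOn_chartConnection x₀) p w v) := by
  have hv := (isInvertible_chartDeriv hp).inverse_apply_self v
  have hw := (isInvertible_chartDeriv hp).inverse_apply_self w
  rw [christoffel, (extChartAt 𝓘(ℝ, E) x₀).left_inv hp]
  change chartDeriv E x₀ p (IsCovariantDerivativeOn.difference _ _ p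
    ((chartDeriv E x₀ p).inverse (chartDeriv E x₀ p w))
    ((chartDeriv E x₀ p).inverse (chartDeriv E x₀ p v))) = _
  rw [hv, hw]

theorem chartDeriv_covariantDerivative (hp : p ∈ (extChartAt 𝓘(ℝ, E) x₀).source)
    (hX : MDiffAt (T% X) p) (v : TangentSpace 𝓘(ℝ, E) p) :
    chartDeriv E x₀ p (D X p v) =
      fderiv ℝ (coords x₀ X) (extChartAt 𝓘(ℝ, E) x₀ p) (chartDeriv E x₀ p v) +
        christoffel D x₀ (extChartAt 𝓘(ℝ, E) x₀ p) (chartDeriv E x₀ p v)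
          (chartDeriv E x₀ p (X p)) := by
  rw [christoffel_chartDeriv_chartDeriv hp, IsCovariantDerivativeOn.difference_apply _ _ hp hX,
    sub_apply, map_sub, chartDeriv_chartConnection hp, add_sub_cancel]

theorem coords_covariantDerivative (hp : p ∈ (extChartAt 𝓘(ℝ, E) x₀).source)
    (hY : MDiffAt (T% Y) p) :
    coords x₀ (fun q ↦ D Y q (X q)) (extChartAt 𝓘(ℝ, E) x₀ p) =
      coordNabla (christoffel D x₀) (coords x₀ X) (coords x₀ Y) (extChartAt 𝓘(ℝ, E) x₀ p) := by
  rw [coordNabla, coords_extChartAt hp, coords_extChartAt hp, coords_extChartAt hp,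
    chartDeriv_covariantDerivative hp hY]

theorem christoffel_extChartAt (hp : p ∈ (extChartAt 𝓘(ℝ, E) x₀).source) (u w : E) :
    christoffel D x₀ (extChartAt 𝓘(ℝ, E) x₀ p) u w =
      chartDeriv E x₀ p (D (ofCoords x₀ fun _ ↦ w) p (ofCoords x₀ (fun _ ↦ u) p)) := by
  have hw : CMDiffAt ∞ (T% (ofCoords (E := E) x₀ fun _ ↦ w)) p :=
    contMDiffAt_ofCoords hp contDiffAt_const
  rw [chartDeriv_covariantDerivative hp (hw.mdifferentiableAt (by simp)),
    (coords_ofCoords_eventuallyEq hp).fderiv_eq, fderiv_fun_const, ofCoords_apply, ofCoords_apply,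
    chartDeriv_inverse_apply hp, chartDeriv_inverse_apply hp, Pi.zero_apply, zero_apply, zero_add]

variable [T2Space M]

theorem exists_contMDiff_eventuallyEq (hU : IsOpen U) (hp : p ∈ U) (hX : CMDiff[U] ∞ (T% X)) :
    ∃ X' : (p : M) → TangentSpace 𝓘(ℝ, E) p, CMDiff ∞ (T% X') ∧ X' =ᶠ[𝓝 p] X := by
  obtain ⟨ψ, -, hψ⟩ :=
    (SmoothBumpFunction.nhds_basis_tsupport (I := 𝓘(ℝ, E)) p).mem_iff.1 (hU.mem_nhds hp)
  refine ⟨(ψ : M → ℝ) • X,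
    ContMDiffOn.smul_section_of_tsupport ψ.contMDiff.contMDiffOn hU hψ hX, ?_⟩
  filter_upwards [ψ.eventuallyEq_one] with q hq
  rw [Pi.smul_apply', hq, Pi.one_apply, one_smul]

variable (hD : CovariantDerivative.ContMDiffCovariantDerivative D ∞)

include hD

theorem contMDiffOn_covariantDerivative_apply (hU : IsOpen U) (hX : CMDiff[U] ∞ (T% X))
    (hY : CMDiff[U] ∞ (T% Y)) : CMDiff[U] ∞ (T% fun q ↦ D Y q (X q)) := by
  intro p hp
  obtain ⟨Y', hY', hYY'⟩ := exists_contMDiff_eventuallyEq hU hp hY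
  have hDY' := hD.contMDiff.contMDiff (σ := Y') hY'.contMDiffOn
  have hDXY' : CMDiffAt ∞ (T% fun q ↦ D Y' q (X q)) p :=
    (hDY'.contMDiffAt Filter.univ_mem).clm_bundle_apply (hX.contMDiffAt (hU.mem_nhds hp))
  refine (hDXY'.congr_of_eventuallyEq ?_).contMDiffWithinAt
  filter_upwards [hYY'.eventually_nhds, hU.mem_nhds hp] with q hq hqU
  have hDq := D.isCovariantDerivativeOnUniv.congr_of_eventuallyEq
    (hY'.contMDiffAt.mdifferentiableAt (by simp))
    ((hY.contMDiffAt (hU.mem_nhds hqU)).mdifferentiableAt (by simp)) Filter.univ_mem hq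
  rw [hDq]

theorem contDiffOn_christoffel (x₀ : M) :
    ContDiffOn ℝ ∞ (christoffel D x₀) (extChartAt 𝓘(ℝ, E) x₀).target := by
  have hopen := isOpen_extChartAt_source (I := 𝓘(ℝ, E)) x₀
  have hconst (w : E) : CMDiff[(extChartAt 𝓘(ℝ, E) x₀).source] ∞
      (T% (ofCoords (E := E) x₀ fun _ ↦ w)) :=
    fun q hq ↦ (contMDiffAt_ofCoords hq contDiffAt_const).contMDiffWithinAt
  refine contDiffOn_clm_apply.2 fun u ↦ contDiffOn_clm_apply.2 fun w y hy ↦ ?_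
  have hp := (extChartAt 𝓘(ℝ, E) x₀).map_target hy
  have hDuw := contMDiffOn_covariantDerivative_apply hD hopen (hconst u) (hconst w)
  have hcoords := contDiffAt_coords hp (hDuw.contMDiffAt (hopen.mem_nhds hp))
  rw [(extChartAt 𝓘(ℝ, E) x₀).right_inv hy] at hcoords
  refine hcoords.contDiffWithinAt.congr_of_mem (s := (extChartAt 𝓘(ℝ, E) x₀).target)
    (fun z hz ↦ ?_) hy
  have hq := (extChartAt 𝓘(ℝ, E) x₀).map_target hz
  rw [← (extChartAt 𝓘(ℝ, E) x₀).right_inv hz, coords_extChartAt hq, christoffel_extChartAt hq]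

theorem chartDeriv_iterated_covariantDerivative (hU : IsOpen U) (hY : CMDiff[U] ∞ (T% Y))
    (hZ : CMDiff[U] ∞ (T% Z)) (hpU : p ∈ U) (hp : p ∈ (extChartAt 𝓘(ℝ, E) x₀).source) :
    chartDeriv E x₀ p (D (fun q ↦ D Z q (Y q)) p (X p)) =
      coordNabla (christoffel D x₀) (coords x₀ X)
        (coordNabla (christoffel D x₀) (coords x₀ Y) (coords x₀ Z))
        (extChartAt 𝓘(ℝ, E) x₀ p) := by
  have hcoords : coords x₀ (fun q ↦ D Z q (Y q)) =ᶠ[𝓝 (extChartAt 𝓘(ℝ, E) x₀ p)]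
      coordNabla (christoffel D x₀) (coords x₀ Y) (coords x₀ Z) := by
    refine eventually_of_eventually_extChartAt hp ?_
    filter_upwards [hU.mem_nhds hpU, extChartAt_source_mem_nhds' hp] with q hqU hq
    exact coords_covariantDerivative hq
      ((hZ.contMDiffAt (hU.mem_nhds hqU)).mdifferentiableAt (by simp))
  have hYZ := (contMDiffOn_covariantDerivative_apply hD hU hY hZ).contMDiffAt (hU.mem_nhds hpU)
  rw [← coords_extChartAt hp (fun q ↦ D (fun q ↦ D Z q (Y q)) q (X q)),
    coords_covariantDerivative hp (hYZ.mdifferentiableAt (by simp)), coordNabla, hcoords.fderiv_eq,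
    hcoords.eq_of_nhds]
  rfl

theorem chartDeriv_curvature (hU : IsOpen U) (hX : CMDiff[U] ∞ (T% X)) (hY : CMDiff[U] ∞ (T% Y))
    (hZ : CMDiff[U] ∞ (T% Z)) (hpU : p ∈ U) (hp : p ∈ (extChartAt 𝓘(ℝ, E) x₀).source) :
    chartDeriv E x₀ p (D (fun q ↦ D Z q (Y q)) p (X p) - D (fun q ↦ D Z q (X q)) p (Y p)
        - D Z p (VectorField.mlieBracket 𝓘(ℝ, E) X Y p)) =
      coordCurv (christoffel D x₀) (extChartAt 𝓘(ℝ, E) x₀ p) (chartDeriv E x₀ p (X p))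
        (chartDeriv E x₀ p (Y p)) (chartDeriv E x₀ p (Z p)) := by
  have hX' := hX.contMDiffAt (hU.mem_nhds hpU)
  have hY' := hY.contMDiffAt (hU.mem_nhds hpU)
  have hZ' := hZ.contMDiffAt (hU.mem_nhds hpU)
  have hΓ : DifferentiableAt ℝ (christoffel D x₀) (extChartAt 𝓘(ℝ, E) x₀ p) :=
    ((contDiffOn_christoffel hD x₀).contDiffAt
      (extChartAt_target_mem_nhds' ((extChartAt 𝓘(ℝ, E) x₀).map_source hp))).differentiableAt
      (by simp)
  have hcomm := coordNabla_coordNabla_sub_coordNabla_lieBracket hΓ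
    ((contDiffAt_coords hp hX').differentiableAt (by simp))
    ((contDiffAt_coords hp hY').differentiableAt (by simp))
    ((contDiffAt_coords hp hZ').of_le (by norm_cast))
  rw [map_sub, map_sub, chartDeriv_iterated_covariantDerivative hD hU hY hZ hpU hp,
    chartDeriv_iterated_covariantDerivative hD hU hX hZ hpU hp,
    chartDeriv_covariantDerivative hp (hZ'.mdifferentiableAt (by simp)),
    chartDeriv_mlieBracket hp (hX'.mdifferentiableAt (by simp))
      (hY'.mdifferentiableAt (by simp)), ← coords_extChartAt hp X, ← coords_extChartAt hp Y,
    ← coords_extChartAt hp Z, ← hcomm]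
  rfl

end Christoffel

section Flatness

variable {m : ℕ} {M : Type*} [TopologicalSpace M] [ChartedSpace (EuclideanSpace ℝ (Fin m)) M]

theorem finrank_tangentSpace (x : M) : Module.finrank ℝ (TangentSpace (model m) x) = m :=
  finrank_euclideanSpace_fin (𝕜 := ℝ) (n := m)

variable [IsManifold (model m) ∞ M] {x : M} {D : Connection m M} {U : Set M}
  {X Y Z : VField m M}

theorem SmoothOn.contMDiffAt (hX : SmoothOn X U) (hU : IsOpen U) (hx : x ∈ U) :
    ContMDiffAt (model m) (model m).tangent ∞
      (fun x ↦ (⟨x, X x⟩ : TangentBundle (model m) M)) x :=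
  ContMDiffOn.contMDiffAt hX (hU.mem_nhds hx)

theorem SmoothOn.mdifferentiableAt (hX : SmoothOn X U) (hU : IsOpen U) (hx : x ∈ U) :
    MDifferentiableAt (model m) (model m).tangent
      (fun x ↦ (⟨x, X x⟩ : TangentBundle (model m) M)) x :=
  (hX.contMDiffAt hU hx).mdifferentiableAt (by simp)

theorem SmoothOn.mono {V : Set M} (hX : SmoothOn X V) (hUV : U ⊆ V) : SmoothOn X U :=
  ContMDiffOn.mono hX hUV

theorem Connection.curv_eq_hess_sub_hess (hD : D.torsion = 0)
    (hY : MDifferentiableAt (model m) (model m).tangent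
      (fun x ↦ (⟨x, Y x⟩ : TangentBundle (model m) M)) x)
    (hZ : MDifferentiableAt (model m) (model m).tangent
      (fun x ↦ (⟨x, Z x⟩ : TangentBundle (model m) M)) x) :
    D.curv Y Z X x = D.hess X Y Z x - D.hess X Z Y x := by
  have hbracket : D.nabla (VectorField.mlieBracket (model m) Y Z) X x =
      D.nabla (D.nabla Y Z) X x - D.nabla (D.nabla Z Y) X x := by
    rw [Connection.nabla, ← D.torsion_eq_zero_iff.1 hD hY hZ, map_sub]
    rfl
  simp only [Connection.curv, Connection.hess, Pi.sub_apply, hbracket]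
  abel

theorem Connection.isSolutionOn_of_parallel (hU : IsOpen U) (hX : SmoothOn X U)
    (hpar : ∀ p ∈ U, D X p = 0) : D.IsSolutionOn X U := by
  refine ⟨hX, fun Y Z _ _ p hp ↦ ?_⟩
  have hZX : D.nabla Z X =ᶠ[𝓝 p] 0 := by
    filter_upwards [hU.mem_nhds hp] with q hq
    rw [Connection.nabla, hpar q hq]
    rfl
  have hzero : MDifferentiableAt (model m) (model m).tangent
      (fun x ↦ (⟨x, (0 : VField m M) x⟩ : TangentBundle (model m) M)) p :=
    Bundle.mdifferentiableAt_zeroSection ..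
  have hdiff : MDifferentiableAt (model m) (model m).tangent
      (fun x ↦ (⟨x, D.nabla Z X x⟩ : TangentBundle (model m) M)) p :=
    hzero.congr_of_eventuallyEq (hZX.mono fun q hq ↦ congrArg (Bundle.TotalSpace.mk q) hq)
  have hDZX : D (D.nabla Z X) p = 0 :=
    (D.isCovariantDerivativeOnUniv.congr_of_eventuallyEq hdiff hzero Filter.univ_mem hZX).trans
      D.isCovariantDerivativeOnUniv.zero
  rw [Connection.hess, Pi.sub_apply, Connection.nabla, hDZX, Connection.nabla, hpar p hp,
    zero_apply, zero_apply, sub_zero]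

variable [T2Space M]

theorem Connection.chartDeriv_curv (hD : CovariantDerivative.ContMDiffCovariantDerivative D ∞)
    (hU : IsOpen U) (hX : SmoothOn X U) (hY : SmoothOn Y U) (hZ : SmoothOn Z U) {p : M}
    (hpU : p ∈ U) (hp : p ∈ (extChartAt (model m) x).source) :
    chartDeriv _ x p (D.curv X Y Z p) = coordCurv (christoffel D x) (extChartAt (model m) x p)
      (chartDeriv _ x p (X p)) (chartDeriv _ x p (Y p)) (chartDeriv _ x p (Z p)) :=
  chartDeriv_curvature hD hU hX hY hZ hpU hp

theorem Connection.IsSymmetric.isLocallyFlat_of_solSpan_eq_top (hD : D.IsSymmetric)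
    (h : ∀ x, D.solSpan x = ⊤) : D.IsLocallyFlat := by
  refine ⟨hD, fun X Y Z hX hY hZ ↦ funext fun x ↦ ?_⟩
  have hx := mem_extChartAt_source (I := model m) x
  have hker : D.solSpan x ≤ LinearMap.ker (coordCurv (christoffel D x) (extChartAt (model m) x x)
      (chartDeriv _ x x (X x)) (chartDeriv _ x x (Y x)) ∘L chartDeriv _ x x).toLinearMap := by
    refine Submodule.span_le.2 ?_
    rintro _ ⟨U, W, hU, hxU, hW, rfl⟩
    have hcurv : D.curv X Y W x = 0 := by
      rw [curv_eq_hess_sub_hess hD.torsion_eq_zero (hX.mdifferentiableAt isOpen_univ trivial)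
        (hY.mdifferentiableAt isOpen_univ trivial), hW.hess_eq_zero X Y hX hY x hxU,
        hW.hess_eq_zero Y X hY hX x hxU, sub_zero]
    have hcoord := chartDeriv_curv hD.smooth hU (hX.mono (Set.subset_univ U))
      (hY.mono (Set.subset_univ U)) hW.smooth hxU hx
    rw [hcurv, map_zero] at hcoord
    exact hcoord.symm
  have hZx : Z x ∈ D.solSpan x := h x ▸ Submodule.mem_top
  apply (isInvertible_chartDeriv hx).injective
  rw [chartDeriv_curv hD.smooth isOpen_univ hX hY hZ trivial hx]
  exact (hker hZx).trans (map_zero _).symm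

theorem exists_smoothOn_univ_chartDeriv_eq {p : M} (hp : p ∈ (extChartAt (model m) x).source)
    (w : EuclideanSpace ℝ (Fin m)) :
    ∃ X : VField m M, SmoothOn X Set.univ ∧ chartDeriv _ x p (X p) = w := by
  have hconst : SmoothOn (ofCoords x fun _ ↦ w) (extChartAt (model m) x).source :=
    fun q hq ↦ (contMDiffAt_ofCoords hq contDiffAt_const).contMDiffWithinAt
  obtain ⟨X, hX, hXw⟩ := exists_contMDiff_eventuallyEq (isOpen_extChartAt_source x) hp hconst
  refine ⟨X, hX.contMDiffOn, ?_⟩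
  rw [hXw.self_of_nhds, ofCoords_apply, chartDeriv_inverse_apply hp]

theorem Connection.IsLocallyFlat.coordCurv_christoffel_eq_zero (hD : D.IsLocallyFlat)
    {y : EuclideanSpace ℝ (Fin m)} (hy : y ∈ (extChartAt (model m) x).target)
    (u v : EuclideanSpace ℝ (Fin m)) : coordCurv (christoffel D x) y u v = 0 := by
  ext1 w
  have hp := (extChartAt (model m) x).map_target hy
  obtain ⟨X, hX, rfl⟩ := exists_smoothOn_univ_chartDeriv_eq hp u
  obtain ⟨Y, hY, rfl⟩ := exists_smoothOn_univ_chartDeriv_eq hp v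
  obtain ⟨Z, hZ, rfl⟩ := exists_smoothOn_univ_chartDeriv_eq hp w
  have hcurv := chartDeriv_curv hD.smooth isOpen_univ hX hY hZ trivial hp
  rw [hD.curv_eq_zero X Y Z hX hY hZ, (extChartAt (model m) x).right_inv hy] at hcurv
  exact hcurv.symm.trans (map_zero _)

theorem Connection.IsLocallyFlat.isFlatOn_neg_christoffel (hD : D.IsLocallyFlat) (x : M) :
    IsFlatOn (fun y ↦ -christoffel D x y) (extChartAt (model m) x).target := by
  intro y hy u v w
  have h := DFunLike.congr_fun (hD.coordCurv_christoffel_eq_zero hy v u) w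
  simp only [coordCurv, add_apply, sub_apply, ContinuousLinearMap.comp_apply, zero_apply] at h
  simp only [fderiv_fun_neg, neg_apply, map_neg, neg_neg]
  rw [← sub_eq_zero, ← h]
  abel

theorem Connection.IsLocallyFlat.exists_parallel (hD : D.IsLocallyFlat)
    (v : TangentSpace (model m) x) : ∃ (U : Set M) (X : VField m M), IsOpen U ∧ x ∈ U ∧
      SmoothOn X U ∧ (∀ p ∈ U, D X p = 0) ∧ X x = v := by
  have hx := mem_extChartAt_source (I := model m) x
  have hΓ : ContDiffOn ℝ ∞ (fun y ↦ -christoffel D x y) (extChartAt (model m) x).target :=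
    (contDiffOn_christoffel hD.smooth x).neg
  obtain ⟨r, hr, hball, hsol⟩ := exists_forall_hasFDerivAt_of_isFlatOn
    (isOpen_extChartAt_target x) (hΓ.of_le (by norm_cast)) (hD.isFlatOn_neg_christoffel x)
    (mem_extChartAt_target x)
  obtain ⟨f, hfx, hf⟩ := hsol (chartDeriv _ x x v)
  have hfsmooth := contDiffOn_infty_of_hasFDerivAt_flip Metric.isOpen_ball hf (hΓ.mono hball)
  have hU := isOpen_extChartAt_preimage (I := model m) x (Metric.isOpen_ball (ε := r)
    (x := extChartAt (model m) x x))
  rw [← extChartAt_source (model m)] at hU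
  have hX : SmoothOn (ofCoords x f) ((extChartAt (model m) x).source ∩
      extChartAt (model m) x ⁻¹' Metric.ball (extChartAt (model m) x x) r) := fun q hq ↦
    (contMDiffAt_ofCoords hq.1
      (hfsmooth.contDiffAt (Metric.isOpen_ball.mem_nhds hq.2))).contMDiffWithinAt
  refine ⟨_, ofCoords x f, hU, ⟨hx, Metric.mem_ball_self hr⟩, hX, fun p hp ↦ ?_, ?_⟩
  · ext1 u
    apply (isInvertible_chartDeriv hp.1).injective
    rw [chartDeriv_covariantDerivative hp.1 (hX.mdifferentiableAt hU hp),
      (coords_ofCoords_eventuallyEq hp.1).fderiv_eq, (hf _ hp.2).fderiv, ofCoords_apply,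
      chartDeriv_inverse_apply hp.1]
    simp
  · rw [ofCoords_apply, hfx]
    exact (isInvertible_chartDeriv hx).inverse_apply_self v

theorem Connection.IsLocallyFlat.solSpan_eq_top (hD : D.IsLocallyFlat) (x : M) :
    D.solSpan x = ⊤ := by
  refine Submodule.eq_top_iff'.2 fun v ↦ Submodule.subset_span ?_
  obtain ⟨U, X, hU, hxU, hX, hpar, hv⟩ := hD.exists_parallel v
  exact ⟨U, X, hU, hxU, isSolutionOn_of_parallel hU hX hpar, hv⟩

end Flatness

section Minimum

variable {m : ℕ} {M : Type*} [TopologicalSpace M] [ChartedSpace (EuclideanSpace ℝ (Fin m)) M]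
  [IsManifold (model m) ∞ M]

theorem Connection.rb_eq_iff [Nonempty M] {D : Connection m M} :
    D.rb = m ↔ ∀ x, D.solSpan x = ⊤ := by
  constructor
  · intro h x
    have : FiniteDimensional ℝ (TangentSpace (model m) x) :=
      inferInstanceAs (FiniteDimensional ℝ (EuclideanSpace ℝ (Fin m)))
    have hx : m ≤ Module.finrank ℝ (D.solSpan x) := h.ge.trans (ciInf_le (OrderBot.bddBelow _) x)
    exact Submodule.eq_top_of_finrank_eq <|
      (Submodule.finrank_le _).antisymm (by rwa [finrank_tangentSpace])
  · intro h
    have hx (x : M) : Module.finrank ℝ (D.solSpan x) = m := by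
      rw [h, finrank_top, finrank_tangentSpace]
    simp only [rb, hx, ciInf_const]

theorem rbManifold_eq_zero_iff :
    rbManifold m M = 0 ↔ ∃ D : Connection m M, D.IsSymmetric ∧ D.rb = m := by
  simp only [rbManifold, ENat.iInf_eq_zero, Nat.cast_eq_zero, Nat.sub_eq_zero_iff_le,
    Subtype.exists, exists_prop]
  exact exists_congr fun D ↦ and_congr_right fun _ ↦ ⟨D.rb_le.antisymm, Eq.ge⟩

end Minimum

end LocallyFlat

end

theorem mainTheorem1_general (m : ℕ) (M : Type*) [TopologicalSpace M] [T2Space M] [Nonempty M]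
    [ChartedSpace (EuclideanSpace ℝ (Fin m)) M] [IsManifold (LocallyFlat.model m) ∞ M] :
    LocallyFlat.rbManifold m M = 0 ↔
      ∃ D : LocallyFlat.Connection m M, D.IsLocallyFlat := by
  simp only [LocallyFlat.rbManifold_eq_zero_iff, LocallyFlat.Connection.rb_eq_iff]
  exact exists_congr fun D ↦ ⟨fun h ↦ h.1.isLocallyFlat_of_solSpan_eq_top h.2,
    fun h ↦ ⟨h.toIsSymmetric, h.solSpan_eq_top⟩⟩

theorem mainTheorem1 (m : ℕ) (M : Type*) [TopologicalSpace M] [T2Space M] [ParacompactSpace M]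
    [ConnectedSpace M] [ChartedSpace (EuclideanSpace ℝ (Fin m)) M]
    [IsManifold (LocallyFlat.model m) ∞ M] :
    LocallyFlat.rbManifold m M = 0 ↔
      ∃ D : LocallyFlat.Connection m M, D.IsLocallyFlat :=
  mainTheorem1_general m M
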